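/- Let $\mathbb F_q\subseteq\mathbb F_{q_1}$ be finite fields. For a linear code $\mathcal C\subseteq\mathbb F^n$ and integers $r\ge 1$, $\delta\ge 2$, an $(r,\delta)$-repair set is a set $B\subseteq[n]$ of coordinates with $|B|\le r+\delta-1$ such that for every $l\in B$ and every $L\subseteq B\setminus\{l\}$ with $|L|=\max\{|B|-(\delta-1),0\}$, the symbol $c_l$ is a linear function of $(c_i)_{i\in L}$ for $\mathbf c=(c_1,\dots,c_n)\in\mathcal C$. The code has $(r,\delta)_a$-locality if every coordinate lies in some $(r,\delta)$-repair set. An $[n,k,d]$ code with $(r,\delta)_a$-locality is optimal if every linear code of length $n$ and dimension $k$ with $(r,\delta)_a$-locality, over any finite field, has minimum Hamming distance at most $d$. A set $S\subseteq\mathbb F_{q_1}$ is $t$-wise independent over $\mathbb F_q$ if every $T\subseteq S$ with $|T|\le t$ is linearly independent over $\mathbb F_q$. Let $n=w(r+\delta-1)+m$ and $k=ur+v$ with nonnegative integers $w,m,u,v$, where $\delta\ge2$, $\delta\le m<r+\delta-1$, $$r>v>\max\{m-\delta+1,\lfloor r/2\rfloor\},\qquad u\ge\max\{2(r+\delta-1-m),\,r+\delta-1\},$$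 and suppose that $h:=n-k-(w+1)(\delta-1)\ge 0$ (under these assumptions this is equivalent to $w>u$). Let $A$ be a $(\delta-1)\times(r+\delta-1)$ parity-check matrix over $\mathbb F_q$ of an $[r+\delta-1,r,\delta]_q$ MDS code, and let $A_1$ be $A$ without its last column. Let $S=\{\alpha_1,\dots,\alpha_n\}\subseteq\mathbb F_{q_1}$ be a set of $n$ elements, enumerated in any order, that is $(h+(w-u)(\delta-1))$-wise independent over $\mathbb F_q$, and let $V(S,h)$ be the $h\times n$ matrix whose entry in row $i$ and column $j$ is $\alpha_j^{q^{i-1}}$. Let $\mathcal C(S,h)\subseteq\mathbb F_{q_1}^n$ be the linear code with parity-check matrix $$R=\begin{pmatrix}R_1&0&\cdots&0\\0&R_2&\cdots&0\\ \vdots&\vdots&\ddots&\vdots\\0&0&\cdots&R_{w+1}\\H_1&H_2&\cdots&H_{w+1}\end{pmatrix},\qquad (H_1,\dots,H_{w+1})=V(S,h),$$ where $R_i=A_1$ for $1\le i\le r+\delta-1-m$ and $R_i=A$ for $r+\delta-m\le i\le w+1$. Then $\mathcal C(S,h)$ is an optimal $[n,k,d]_{q_1}$ linear code with $(r,\delta)_a$-locality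 and $d=h+(w-u)(\delta-1)+1$. -/

import Mathlib

universe u v

/-- The linear code `C`, with coordinates indexed by the finite type `ι`, is an `[n, k, d]` code:
it has length `n`, dimension `k` and minimum Hamming distance exactly `d`. -/
structure IsLinearCode {ι : Type*} [Fintype ι] {F : Type*} [Field F]
    (C : Submodule F (ι → F)) (n k d : ℕ) : Prop where
  length_eq : Fintype.card ι = n
  dim_eq : Module.finrank F C = k
  dist_isLeast : open scoped Classical in
    IsLeast {e : ℕ | ∃ x ∈ C, ∃ y ∈ C, x ≠ y ∧ hammingDist x y = e} d

/-- `S` is an `(r, δ)`-repair set of `C`: it has at most `r + δ - 1` elements, and for each `l ∈ S`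
and each `L ⊆ S \ {l}` with `|S| - (δ - 1)` elements, the symbol `c_l` is a linear function of the
symbols `c_i`, `i ∈ L`. The truncated subtraction is intended: if `|S| ≤ δ - 1`, all the symbols of
`S` may be erased at once, so they have to vanish on `C`. -/
def IsRepairSet {ι : Type*} {F : Type*} [Field F]
    (C : Submodule F (ι → F)) (r δ : ℕ) (S : Finset ι) : Prop :=
  S.card ≤ r + δ - 1 ∧
    ∀ l ∈ S, ∀ L : Finset ι, L ⊆ S → l ∉ L → L.card = S.card - (δ - 1) →
      ∃ a : ι → F, ∀ c ∈ C, c l = ∑ i ∈ L, a i * c i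

/-- All-symbol `(r, δ)`-locality: every coordinate lies in an `(r, δ)`-repair set. -/
def HasAllSymbolLocality {ι : Type*} {F : Type*} [Field F]
    (C : Submodule F (ι → F)) (r δ : ℕ) : Prop :=
  ∀ i : ι, ∃ S : Finset ι, i ∈ S ∧ IsRepairSet C r δ S

/-- `C` is an optimal `[n, k, d]` code with all-symbol `(r, δ)`-locality: no code of length `n` and
dimension `k` with all-symbol `(r, δ)`-locality, over any finite field, has a larger minimum
distance. -/
structure IsOptimalLRC {ι : Type*} [Fintype ι] {K : Type u} [Field K]
    (C : Submodule K (ι → K)) (n k d r δ : ℕ) : Prop where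
  isLinearCode : IsLinearCode C n k d
  locality : HasAllSymbolLocality C r δ
  optimal : ∀ (E : Type u) [Field E] [Finite E] (D : Submodule E (Fin n → E)) (d' : ℕ),
    IsLinearCode D n k d' → HasAllSymbolLocality D r δ → d' ≤ d

/-- The code with parity-check matrix `H`. -/
def parityCheckCode {ρ ι F : Type*} [Fintype ι] [Field F] (H : Matrix ρ ι F) :
    Submodule F (ι → F) :=
  LinearMap.ker H.mulVecLin

/-- `S ⊆ K` is `t`-wise independent over `F`: every `T ⊆ S` with `|T| ≤ t` is linearly
independent over `F`. -/
def IsWiseIndependent (F : Type*) {K : Type*} [Field F] [Field K] [Algebra F K]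
    (t : ℕ) (S : Set K) : Prop :=
  ∀ T : Finset K, (T : Set K) ⊆ S → T.card ≤ t →
    LinearIndependent F (fun x : T => (x : K))

/-- The matrix with entries `α_j ^ (q ^ i)`, `0 ≤ i < h`. -/
def mooreMatrix {ι K : Type*} [Field K] (q h : ℕ) (α : ι → K) : Matrix (Fin h) ι K :=
  Matrix.of fun i j => α j ^ q ^ (i : ℕ)

namespace ConstructionA

/-- The number of columns of the `i`-th diagonal block, with `i` counted from `0`: the first
`r + δ - 1 - m` blocks have `r + δ - 2` columns, the others have `r + δ - 1`. -/
def blockSize (r δ m i : ℕ) : ℕ :=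
  if i < r + δ - 1 - m then r + δ - 2 else r + δ - 1

theorem blockSize_le (r δ m i : ℕ) : blockSize r δ m i ≤ r + δ - 1 := by
  unfold blockSize
  split <;> omega

/-- The coordinates of the code: pairs of a block `i` and a position inside this block. -/
abbrev Coord (r δ m w : ℕ) : Type :=
  (i : Fin (w + 1)) × Fin (blockSize r δ m i)

/-- The parity-check matrix: the `i`-th diagonal block consists of the first `blockSize r δ m i`
columns of `A` (so it is `A` or `A` without its last column), and the last `h` rows are
the matrix of the powers `α_j ^ (q ^ i)`, where `q = |F|`. -/
def parityCheck {F K : Type*} [Field F] [Fintype F] [Field K] [Algebra F K] (r δ m w h : ℕ)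
    (A : Matrix (Fin (δ - 1)) (Fin (r + δ - 1)) F) (α : Coord r δ m w → K) :
    Matrix ((Fin (w + 1) × Fin (δ - 1)) ⊕ Fin h) (Coord r δ m w) K :=
  Matrix.fromRows
    (Matrix.of fun a j =>
      if a.1 = j.1 then
        algebraMap F K (A a.2 (Fin.castLE (blockSize_le r δ m j.1) j.2))
      else 0)
    (mooreMatrix (Fintype.card F) h α)

/-- The code with the above parity-check matrix. -/
def code {F K : Type*} [Field F] [Fintype F] [Field K] [Algebra F K] (r δ m w h : ℕ)
    (A : Matrix (Fin (δ - 1)) (Fin (r + δ - 1)) F) (α : Coord r δ m w → K) :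
    Submodule K (Coord r δ m w → K) :=
  parityCheckCode (parityCheck r δ m w h A α)

end ConstructionA

/-!
Identify the coordinates of a code of dimension `k` with linear functionals on it, and call
`|T| - rank T` the nullity of a set `T` of coordinates. The Singleton bound for the shortening of
the code at a set `T` of rank less than `k` says that `d ≤ n - k + 1` minus the nullity of `T`,
while adjoining to `T` a repair set not contained in its span raises the nullity by at least
`δ - 1`. If `d` were too large, then any `u + 1` repair sets with distinct spans could be adjoined
one after the other, and their union would fall short of the size `(u + 1) (r + δ - 1)` by at most
`r - v`. But all the repair sets together fall short by at least `r + δ - 1 - m > r - v`, and that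
much of the deficit is already attained on at most `2 (r + δ - 1 - m) ≤ u` of them.

For the construction, the local checks express `δ - 1` symbols of each block as combinations over
`F` of the others. A codeword of weight at most `h + (w - u) (δ - 1)` therefore spans a space of
dimension at most `h` over `F`, and it vanishes because the last `h` rows define a Gabidulin code,
whose rank distance exceeds `h`. As the upper bound on `d` holds for every dimension that is at
least `k`, it also forces the dimension of the code to be `k`.
-/

open Finset Module

section SpanRank

variable {ι E V : Type*} [Field E] [AddCommGroup V] [Module E V]

/-- The span of the vectors `φ i`, `i ∈ T`. It is the closure of `T` in the linear matroid of `φ`,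
kept as a subspace so that sets of indices can be compared through `≤`. -/
def spanOn (E : Type*) {ι V : Type*} [Field E] [AddCommGroup V] [Module E V]
    (φ : ι → V) (T : Finset ι) : Submodule E V :=
  Submodule.span E (φ '' T)

/-- The rank of the family `φ i`, `i ∈ T`. For the coordinate functionals of a code it is the
dimension of the projection of the code to `T`; for a word over an extension of `E` it is the rank
weight over `E` of the restriction of the word to `T`. -/
noncomputable def rankOn (E : Type*) {ι V : Type*} [Field E] [AddCommGroup V] [Module E V]
    (φ : ι → V) (T : Finset ι) : ℕ :=
  finrank E (spanOn E φ T)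

variable {φ : ι → V} {S T : Finset ι}

instance finiteDimensional_spanOn : FiniteDimensional E (spanOn E φ T) :=
  FiniteDimensional.span_of_finite E (T.finite_toSet.image φ)

theorem mem_spanOn {i : ι} (hi : i ∈ T) : φ i ∈ spanOn E φ T :=
  Submodule.subset_span ⟨i, hi, rfl⟩

theorem spanOn_le {W : Submodule E V} (h : ∀ i ∈ T, φ i ∈ W) : spanOn E φ T ≤ W :=
  Submodule.span_le.2 (Set.image_subset_iff.2 h)

theorem spanOn_mono (h : S ⊆ T) : spanOn E φ S ≤ spanOn E φ T :=
  spanOn_le fun _ hi => mem_spanOn (h hi)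

theorem spanOn_empty (φ : ι → V) : spanOn E φ ∅ = ⊥ := by
  simp [spanOn]

theorem spanOn_union [DecidableEq ι] (φ : ι → V) (S T : Finset ι) :
    spanOn E φ (S ∪ T) = spanOn E φ S ⊔ spanOn E φ T := by
  simp [spanOn, Set.image_union, Submodule.span_union]

theorem spanOn_map {κ : Type*} (φ : ι → V) (g : κ ↪ ι) (T : Finset κ) :
    spanOn E φ (T.map g) = spanOn E (φ ∘ g) T := by
  simp [spanOn, Set.image_image]

theorem rankOn_empty (φ : ι → V) : rankOn E φ ∅ = 0 := by
  rw [rankOn, spanOn_empty, finrank_bot]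

theorem rankOn_le_card (φ : ι → V) (T : Finset ι) : rankOn E φ T ≤ #T := by
  classical
  have h := finrank_span_finset_le_card (R := E) (T.image φ)
  rw [Set.finrank, coe_image] at h
  exact h.trans card_image_le

theorem rankOn_le_of_spanOn_le (h : spanOn E φ S ≤ spanOn E φ T) : rankOn E φ S ≤ rankOn E φ T :=
  Submodule.finrank_mono h

theorem rankOn_union_le [DecidableEq ι] (φ : ι → V) (S T : Finset ι) :
    rankOn E φ (S ∪ T) ≤ rankOn E φ S + rankOn E φ T := by
  rw [rankOn, spanOn_union]
  exact Submodule.finrank_add_le_finrank_add_finrank _ _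

theorem rankOn_biUnion_le {κ : Type*} [DecidableEq ι] (φ : ι → V) (s : Finset κ)
    (f : κ → Finset ι) : rankOn E φ (s.biUnion f) ≤ ∑ c ∈ s, rankOn E φ (f c) := by
  classical
  induction s using Finset.induction_on with
  | empty => simp [rankOn_empty]
  | insert c s hc ih =>
    rw [biUnion_insert, sum_insert hc]
    exact (rankOn_union_le φ _ _).trans (by gcongr)

end SpanRank

section RepairChain

variable {ι E V : Type*} [Field E] [AddCommGroup V] [Module E V]

/-- The linear-algebraic content of being an `(r, ε + 1)`-repair set: after the removal of any
`ε` elements, the remaining vectors span the same space. Writing `ε` for `δ - 1` avoids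
truncated subtraction. -/
structure IsSpanRepair (E : Type*) {ι V : Type*} [Field E] [AddCommGroup V] [Module E V]
    (φ : ι → V) (r ε : ℕ) (B : Finset ι) : Prop where
  card_le : #B ≤ r + ε
  spanOn_le_of_card_le : ∀ L ⊆ B, #B ≤ #L + ε → spanOn E φ B ≤ spanOn E φ L

variable {φ : ι → V} {r ε : ℕ}

theorem IsSpanRepair.rankOn_le {B : Finset ι} (hB : IsSpanRepair E φ r ε B) :
    rankOn E φ B ≤ r := by
  obtain ⟨L, hLB, hL⟩ := exists_subset_card_eq (Nat.sub_le #B ε)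
  calc rankOn E φ B ≤ rankOn E φ L :=
        rankOn_le_of_spanOn_le (hB.spanOn_le_of_card_le L hLB (by omega))
    _ ≤ #L := rankOn_le_card φ L
    _ ≤ r := by have := hB.card_le; omega

variable [DecidableEq ι]

/-- `IsRepairChain E φ r ε S j T`: the set `T` arises from `S` by adjoining `j` repair sets one
after the other, none of them contained in the span of what was there before. -/
inductive IsRepairChain (E : Type*) {ι V : Type*} [Field E] [AddCommGroup V] [Module E V]
    [DecidableEq ι] (φ : ι → V) (r ε : ℕ) (S : Finset ι) : ℕ → Finset ι → Prop
  | refl : IsRepairChain E φ r ε S 0 S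
  | adjoin {j : ℕ} {T B : Finset ι} (hT : IsRepairChain E φ r ε S j T)
      (hB : IsSpanRepair E φ r ε B) (hBT : ¬ spanOn E φ B ≤ spanOn E φ T) :
      IsRepairChain E φ r ε S (j + 1) (T ∪ B)

/-- In other words, the nullity `#T - rankOn E φ T` grows by at least `ε`. Among the at least `ε`
elements of `B` outside the span of `T`, any `ε` may be erased without changing the span. -/
theorem IsSpanRepair.rankOn_union_add_le {B T : Finset ι} (hB : IsSpanRepair E φ r ε B)
    (hBT : ¬ spanOn E φ B ≤ spanOn E φ T) :
    rankOn E φ (T ∪ B) + ε + #T ≤ rankOn E φ T + #(T ∪ B) := by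
  classical
  set inner := B.filter fun i => φ i ∈ spanOn E φ T
  set outer := B.filter fun i => φ i ∉ spanOn E φ T
  have hcard : #inner + #outer = #B := card_filter_add_card_filter_not _
  have houter : ε ≤ #outer := by
    by_contra hlt
    exact hBT ((hB.spanOn_le_of_card_le inner (filter_subset _ _) (by omega)).trans
      (spanOn_le fun i hi => (mem_filter.1 hi).2))
  obtain ⟨Y, hYouter, hY⟩ := exists_subset_card_eq houter
  have hBY : spanOn E φ B ≤ spanOn E φ (B \ Y) := by
    have := card_sdiff_add_card_eq_card (hYouter.trans (filter_subset _ B))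
    exact hB.spanOn_le_of_card_le _ sdiff_subset (by omega)
  have hspan : spanOn E φ (T ∪ B) ≤ spanOn E φ (T ∪ (outer \ Y)) := by
    rw [spanOn_union]
    refine sup_le (spanOn_mono subset_union_left) (hBY.trans (spanOn_le fun i hi => ?_))
    obtain ⟨hiB, hiY⟩ := mem_sdiff.1 hi
    by_cases hiT : φ i ∈ spanOn E φ T
    · exact spanOn_mono subset_union_left hiT
    · exact mem_spanOn (mem_union_right _ (mem_sdiff.2 ⟨mem_filter.2 ⟨hiB, hiT⟩, hiY⟩))
  have hrank : rankOn E φ (T ∪ B) ≤ rankOn E φ T + #(outer \ Y) :=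
    (rankOn_le_of_spanOn_le hspan).trans
      ((rankOn_union_le _ _ _).trans (by gcongr; exact rankOn_le_card _ _))
  have hdisj : Disjoint T outer :=
    disjoint_left.2 fun i hi hi' => (mem_filter.1 hi').2 (mem_spanOn hi)
  have hunion : #T + #outer ≤ #(T ∪ B) := by
    rw [← card_union_of_disjoint hdisj]
    exact card_le_card (union_subset_union_right (filter_subset _ _))
  have := card_sdiff_add_card_eq_card hYouter
  omega

namespace IsRepairChain

variable {S T : Finset ι} {j : ℕ}

theorem rankOn_le (hT : IsRepairChain E φ r ε S j T) :
    rankOn E φ T ≤ rankOn E φ S + j * r := by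
  induction hT with
  | refl => simp
  | @adjoin j T B _ hB _ ih =>
    have := rankOn_union_le (E := E) φ T B
    linarith [hB.rankOn_le]

theorem rankOn_add_le (hT : IsRepairChain E φ r ε S j T) :
    rankOn E φ T + j * ε + #S ≤ rankOn E φ S + #T := by
  induction hT with
  | refl => simp
  | adjoin _ hB hBT ih => linarith [hB.rankOn_union_add_le hBT]

theorem of_isSpanRepair {B : Finset ι} (hB : IsSpanRepair E φ r ε B) (hB0 : spanOn E φ B ≠ ⊥) :
    IsRepairChain E φ r ε ∅ 1 B := by
  have := (refl (S := ∅)).adjoin hB (by rwa [spanOn_empty, le_bot_iff])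
  rwa [empty_union] at this

end IsRepairChain

theorem exists_isRepairChain [Fintype ι] (hcover : ∀ i, ∃ B, i ∈ B ∧ IsSpanRepair E φ r ε B)
    (S : Finset ι) (j : ℕ) (hj : rankOn E φ S + j * r < rankOn E φ univ + r) :
    ∃ T, IsRepairChain E φ r ε S j T := by
  induction j with
  | zero => exact ⟨S, .refl⟩
  | succ j ih =>
    obtain ⟨T, hT⟩ := ih (by linarith)
    obtain ⟨x, hx⟩ : ∃ x, φ x ∉ spanOn E φ T := by
      by_contra! hall
      have := rankOn_le_of_spanOn_le (spanOn_le (T := univ) fun i _ => hall i)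
      linarith [hT.rankOn_le]
    obtain ⟨B, hxB, hB⟩ := hcover x
    exact ⟨T ∪ B, hT.adjoin hB fun hle => hx (hle (mem_spanOn hxB))⟩

end RepairChain

section Deficit

variable {ι κ : Type*} [DecidableEq ι]

/-- If no enlargement of `G` by at most two members increases its deficit
`#G * D - #(G.biUnion f)`, then the remaining members have size `D` and are pairwise disjoint
outside `G.biUnion f`, so that they do not contribute to the deficit of `s`. -/
theorem exists_subset_card_biUnion_add_lt {f : κ → Finset ι} {D a t : ℕ} {s G : Finset κ}
    (hf : ∀ c, #(f c) ≤ D) (hs : #(s.biUnion f) + a ≤ #s * D) (ht : t < a) (hGs : G ⊆ s)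
    (hG : #(G.biUnion f) + t ≤ #G * D) :
    ∃ G' ⊆ s, #G' ≤ #G + 2 ∧ #(G'.biUnion f) + t < #G' * D := by
  classical
  by_contra! hmax
  set g : κ → Finset ι := fun c => f c \ G.biUnion f
  have hg : ∀ c, #(g c) ≤ D := fun c => (card_le_card sdiff_subset).trans (hf c)
  have hextend : ∀ H ⊆ s \ G, #H ≤ 2 → #H * D ≤ #(H.biUnion g) := fun H hH hH2 => by
    have hcard : #(G ∪ H) = #G + #H :=
      card_union_of_disjoint (disjoint_sdiff.mono_right hH)
    have hunion : (G ∪ H).biUnion f ⊆ G.biUnion f ∪ H.biUnion g := fun x hx => by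
      simp only [g, mem_biUnion, mem_union, mem_sdiff] at hx ⊢
      grind
    have hle := hmax _ (union_subset hGs (hH.trans sdiff_subset)) (by omega)
    have := (card_le_card hunion).trans (card_union_le _ _)
    rw [hcard] at hle
    linarith
  have hdisj : ((s \ G : Finset κ) : Set κ).PairwiseDisjoint g := fun b hb c hc hbc => by
    have hpair := hextend {b, c} (by grind) card_le_two
    rw [card_pair hbc, biUnion_insert, singleton_biUnion] at hpair
    have := card_union_add_card_inter (g b) (g c)
    rw [Function.onFun, disjoint_iff_inter_eq_empty, ← card_eq_zero]
    linarith [hg b, hg c]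
  have hrest : #(s \ G) * D ≤ #((s \ G).biUnion g) := by
    rw [card_biUnion hdisj]
    refine card_nsmul_le_sum _ _ _ fun b hb => ?_
    simpa using hextend {b} (singleton_subset_iff.2 hb) (by simp)
  have hsplit : #(G.biUnion f) + #((s \ G).biUnion g) ≤ #(s.biUnion f) := by
    rw [← card_union_of_disjoint (by simp [g, disjoint_biUnion_right, disjoint_sdiff])]
    refine card_le_card (union_subset (biUnion_subset_biUnion_of_subset_left _ hGs) ?_)
    exact biUnion_subset.2 fun c hc =>
      sdiff_subset.trans (subset_biUnion_of_mem f (mem_sdiff.1 hc).1)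
  have hcardG := hmax G hGs (by omega)
  have := card_sdiff_add_card_eq_card hGs
  nlinarith

theorem exists_subset_card_biUnion_add_le {f : κ → Finset ι} {D a : ℕ} {s : Finset κ}
    (hf : ∀ c, #(f c) ≤ D) (hs : #(s.biUnion f) + a ≤ #s * D) :
    ∃ G ⊆ s, #G ≤ 2 * a ∧ #(G.biUnion f) + a ≤ #G * D := by
  suffices h : ∀ t ≤ a, ∃ G ⊆ s, #G ≤ 2 * t ∧ #(G.biUnion f) + t ≤ #G * D from h a le_rfl
  intro t
  induction t with
  | zero => exact fun _ => ⟨∅, by simp⟩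
  | succ t ih =>
    intro ht
    obtain ⟨G, hGs, hGcard, hG⟩ := ih (by omega)
    obtain ⟨G', hG's, hG'card, hG'⟩ := exists_subset_card_biUnion_add_lt hf hs ht hGs hG
    exact ⟨G', hG's, by omega, hG'⟩

end Deficit

section SmallNullity

variable {ι E V : Type*} [Fintype ι] [Field E] [AddCommGroup V] [Module E V]

/-- The negation of the Singleton-type bound for locally repairable codes, expressed through the
family `φ` of coordinate functionals: `φ` is covered by repair sets, has rank at least
`u * r + v`, and each set of smaller rank has nullity less than `(u + 1) * ε`. -/
structure HasSmallNullity (E : Type*) {ι V : Type*} [Fintype ι] [Field E] [AddCommGroup V]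
    [Module E V] (φ : ι → V) (r ε u v : ℕ) : Prop where
  cover : ∀ i, ∃ B, i ∈ B ∧ IsSpanRepair E φ r ε B
  le_rank : u * r + v ≤ rankOn E φ univ
  card_lt : ∀ T, rankOn E φ T < u * r + v → #T < rankOn E φ T + (u + 1) * ε

/-- A family of repair sets that span pairwise distinct nonzero subspaces. -/
structure IsReducedFamily (E : Type*) {ι V κ : Type*} [Field E] [AddCommGroup V] [Module E V]
    (φ : ι → V) (r ε : ℕ) (B : κ → Finset ι) : Prop where
  isSpanRepair : ∀ c, IsSpanRepair E φ r ε (B c)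
  spanOn_ne_bot : ∀ c, spanOn E φ (B c) ≠ ⊥
  injective : Function.Injective fun c => spanOn E φ (B c)

variable {φ : ι → V} {r ε u v : ℕ}

/-- One repair set is chosen for each nonzero subspace that occurs as the span of one. -/
theorem exists_isReducedFamily {ι E : Type*} {V : Type u} [Finite ι] [Field E] [AddCommGroup V]
    [Module E V] {φ : ι → V} {r ε : ℕ} (hcover : ∀ i, ∃ B, i ∈ B ∧ IsSpanRepair E φ r ε B) :
    ∃ (κ : Type u) (_ : Fintype κ) (B : κ → Finset ι), IsReducedFamily E φ r ε B ∧
      ∀ i, φ i ≠ 0 → ∃ c, φ i ∈ spanOn E φ (B c) := by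
  classical
  let κ := {W : Submodule E V // W ≠ ⊥ ∧ ∃ B, IsSpanRepair E φ r ε B ∧ spanOn E φ B = W}
  choose B hB hBW using fun W : κ => W.2.2
  have : Finite κ := Finite.of_injective B fun W W' h =>
    Subtype.ext ((hBW W).symm.trans (h ▸ hBW W'))
  refine ⟨κ, Fintype.ofFinite κ, B, ⟨hB, fun W => (hBW W).symm ▸ W.2.1, fun W W' h =>
    Subtype.ext ((hBW W).symm.trans (h.trans (hBW W')))⟩, fun i hi => ?_⟩
  obtain ⟨S, hiS, hS⟩ := hcover i
  have hmem : φ i ∈ spanOn E φ S := mem_spanOn hiS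
  have hS0 : spanOn E φ S ≠ ⊥ := fun h => hi (by simpa [h] using hmem)
  exact ⟨⟨_, hS0, S, hS, rfl⟩, by rwa [hBW]⟩

namespace HasSmallNullity

variable [DecidableEq ι] {T : Finset ι} {j : ℕ}

/-- Prolonging the chain to `u + 1` repair sets makes its nullity at least `(u + 1) * ε`, hence its
rank at least `u * r + v`. -/
theorem le_card_of_isRepairChain (h : HasSmallNullity E φ r ε u v) (hv : 0 < v) (hj : j ≤ u + 1)
    (hT : IsRepairChain E φ r ε ∅ j T) : j * (r + ε) + v ≤ #T + r := by
  obtain ⟨i, hi⟩ := Nat.exists_eq_add_of_le hj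
  have hur : u * r + r = j * r + i * r := by rw [← add_mul, ← hi, add_one_mul]
  have huε : (u + 1) * ε = j * ε + i * ε := by rw [hi, add_mul]
  have hrankT : rankOn E φ T ≤ j * r := by simpa [rankOn_empty] using hT.rankOn_le
  have hnullT : rankOn E φ T + j * ε ≤ #T := by simpa [rankOn_empty] using hT.rankOn_add_le
  obtain ⟨T', hT'⟩ := exists_isRepairChain h.cover T i (by linarith [h.le_rank])
  have hrank : u * r + v ≤ rankOn E φ T' := by
    by_contra! hlt
    linarith [h.card_lt T' hlt, hT'.rankOn_add_le]
  linarith [hT'.rankOn_le]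

theorem card_lt_of_forall_mem_spanOn (h : HasSmallNullity E φ r ε u v) (hv : 0 < v) (hj : j ≤ u)
    (hT : IsRepairChain E φ r ε ∅ j T) {X : Finset ι} (hdisj : Disjoint T X)
    (hX : ∀ i ∈ X, φ i ∈ spanOn E φ T) : #X < ε := by
  obtain ⟨i, rfl⟩ := Nat.exists_eq_add_of_le hj
  have hrankT : rankOn E φ T ≤ j * r := by simpa [rankOn_empty] using hT.rankOn_le
  have hnullT : rankOn E φ T + j * ε ≤ #T := by simpa [rankOn_empty] using hT.rankOn_add_le
  have hunion : rankOn E φ (T ∪ X) ≤ rankOn E φ T :=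
    rankOn_le_of_spanOn_le (by rw [spanOn_union]; exact sup_le le_rfl (spanOn_le hX))
  obtain ⟨T', hT'⟩ := exists_isRepairChain h.cover (T ∪ X) i (by linarith [h.le_rank])
  have hcard := hT'.rankOn_add_le
  rw [card_union_of_disjoint hdisj] at hcard
  linarith [h.card_lt T' (by linarith [hT'.rankOn_le])]

theorem card_inter_add_le (h : HasSmallNullity E φ r ε u v) (hv : 0 < v) (hu : 1 ≤ u)
    {B B' : Finset ι} (hB : IsSpanRepair E φ r ε B) (hB' : IsSpanRepair E φ r ε B')
    (hB0 : spanOn E φ B ≠ ⊥) (hB'0 : spanOn E φ B' ≠ ⊥)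
    (hne : spanOn E φ B ≠ spanOn E φ B') : #(B ∩ B') + v ≤ r := by
  have hchain : IsRepairChain E φ r ε ∅ 2 (B ∪ B') := by
    by_cases hle : spanOn E φ B' ≤ spanOn E φ B
    · rw [union_comm]
      exact (IsRepairChain.of_isSpanRepair hB' hB'0).adjoin hB fun hle' => hne (hle'.antisymm hle)
    · exact (IsRepairChain.of_isSpanRepair hB hB0).adjoin hB' hle
  linarith [h.le_card_of_isRepairChain hv (by omega) hchain, card_union_add_card_inter B B',
    hB.card_le, hB'.card_le]

/-- If `B'` were spanned by `T ∪ B`, then fewer than `ε` of its elements would lie outside `T ∪ B`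
and few in `B`, so that `T ∪ B'` would be too small. -/
theorem not_spanOn_le_spanOn_union (h : HasSmallNullity E φ r ε u v) (hv : 0 < v) (hrv : r ≤ 2 * v)
    (hj : j + 1 ≤ u) (hT : #T ≤ j * (r + ε)) {B B' : Finset ι}
    (hTB : IsRepairChain E φ r ε ∅ (j + 1) (T ∪ B))
    (hTB' : IsRepairChain E φ r ε ∅ (j + 1) (T ∪ B')) (hinter : #(B ∩ B') + v ≤ r) :
    ¬ spanOn E φ B' ≤ spanOn E φ (T ∪ B) := fun hle => by
  have hX := h.card_lt_of_forall_mem_spanOn hv hj hTB (disjoint_sdiff (t := B'))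
    fun i hi => hle (mem_spanOn (mem_sdiff.1 hi).1)
  have hsub : T ∪ B' ⊆ T ∪ (B ∩ B' ∪ B' \ (T ∪ B)) := by grind
  have hcard : #(T ∪ B') ≤ #T + (#(B ∩ B') + #(B' \ (T ∪ B))) :=
    (card_le_card hsub).trans ((card_union_le _ _).trans (by gcongr; exact card_union_le _ _))
  linarith [h.le_card_of_isRepairChain hv (by omega) hTB']

theorem isRepairChain_biUnion (h : HasSmallNullity E φ r ε u v) (hv : 0 < v) (hrv : r ≤ 2 * v)
    {κ : Type*} {B : κ → Finset ι} (hB : IsReducedFamily E φ r ε B) (G : Finset κ)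
    (hG : #G ≤ u + 1) : IsRepairChain E φ r ε ∅ #G (G.biUnion B) := by
  classical
  induction G using Finset.strongInduction with
  | H G ih =>
    obtain rfl | ⟨c, hc⟩ := G.eq_empty_or_nonempty
    · exact .refl
    obtain ⟨G, hcG, rfl⟩ : ∃ G', c ∉ G' ∧ insert c G' = G := ⟨_, notMem_erase c G, insert_erase hc⟩
    obtain rfl | ⟨d, hd⟩ := G.eq_empty_or_nonempty
    · simpa using IsRepairChain.of_isSpanRepair (hB.isSpanRepair c) (hB.spanOn_ne_bot c)
    obtain ⟨H, hdH, rfl⟩ : ∃ H, d ∉ H ∧ insert d H = G := ⟨_, notMem_erase d G, insert_erase hd⟩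
    have hdc : d ≠ c := fun hdc => hcG (hdc ▸ mem_insert_self d H)
    have hcH : c ∉ H := fun hcH => hcG (mem_insert_of_mem hcH)
    have hchain : ∀ b, b ∉ H → insert b H ⊂ insert c (insert d H) →
        IsRepairChain E φ r ε ∅ (#H + 1) (H.biUnion B ∪ B b) := fun b hbH hb => by
      have := ih _ hb ((card_le_card hb.subset).trans hG)
      rwa [card_insert_of_notMem hbH, biUnion_insert, union_comm] at this
    have hd_chain := hchain d hdH (ssubset_insert hcG)
    have hc_chain := hchain c hcH (by
      rw [Finset.insert_comm]; exact ssubset_insert (by simp [hdc, hdH]))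
    rw [card_insert_of_notMem hcG, card_insert_of_notMem hdH] at hG ⊢
    have hH : #(H.biUnion B) ≤ #H * (r + ε) :=
      card_biUnion_le_card_mul _ _ _ fun b _ => (hB.isSpanRepair b).card_le
    have hinter := h.card_inter_add_le hv (by omega) (hB.isSpanRepair d) (hB.isSpanRepair c)
      (hB.spanOn_ne_bot d) (hB.spanOn_ne_bot c) (hB.injective.ne hdc)
    rw [biUnion_insert, biUnion_insert, union_comm, union_comm (B d)]
    exact hd_chain.adjoin (hB.isSpanRepair c)
      (h.not_spanOn_le_spanOn_union hv hrv (by omega) hH hd_chain hc_chain hinter)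

theorem card_compl_biUnion_lt (h : HasSmallNullity E φ r ε u v) (hv : 0 < v) (hrv : r ≤ 2 * v)
    (hεu : ε ≤ u) {κ : Type*} [Fintype κ] {B : κ → Finset ι} (hB : IsReducedFamily E φ r ε B)
    (hspan : ∀ i, φ i ≠ 0 → ∃ c, φ i ∈ spanOn E φ (B c)) : #(univ.biUnion B)ᶜ < ε := by
  classical
  by_contra! hle
  obtain ⟨X, hX, hXcard⟩ := exists_subset_card_eq hle
  have hmem : ∀ i, ∃ G : Finset κ, #G ≤ 1 ∧ φ i ∈ spanOn E φ (G.biUnion B) := fun i => by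
    by_cases hi : φ i = 0
    · exact ⟨∅, by simp [hi]⟩
    · obtain ⟨c, hc⟩ := hspan i hi
      exact ⟨{c}, by simpa using hc⟩
  choose G hG hiG using hmem
  have hcard : #(X.biUnion G) ≤ u :=
    (card_biUnion_le_card_mul X G 1 fun i _ => hG i).trans (by omega)
  have hdisj : Disjoint ((X.biUnion G).biUnion B) X :=
    disjoint_compl_right.mono (biUnion_subset_biUnion_of_subset_left _ (subset_univ _)) hX
  have hlt := h.card_lt_of_forall_mem_spanOn hv hcard
    (h.isRepairChain_biUnion hv hrv hB _ (by omega)) hdisj fun i hi =>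
      spanOn_mono (biUnion_subset_biUnion_of_subset_left _ (subset_biUnion_of_mem G hi)) (hiG i)
  omega

end HasSmallNullity

/-- A length falling short of a multiple of `r + ε` by `a` forces a total deficit of `a` on the
union of the repair sets, which is concentrated on at most `2 * a ≤ u` of them, whereas the deficit
of a chain of at most `u + 1` repair sets is at most `r - v < a`. -/
theorem not_hasSmallNullity {w a : ℕ} (hcard : Fintype.card ι + a = (w + 1) * (r + ε))
    (har : a ≤ r) (hrav : r < a + v) (hrv : r ≤ 2 * v) (hau : 2 * a ≤ u) (hεu : ε ≤ u) :
    ¬ HasSmallNullity E φ r ε u v := fun h => by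
  classical
  have hv : 0 < v := by omega
  obtain ⟨κ, _, B, hB, hspan⟩ := exists_isReducedFamily h.cover
  have hBcard : ∀ c, #(B c) ≤ r + ε := fun c => (hB.isSpanRepair c).card_le
  have hcompl := h.card_compl_biUnion_lt hv hrv hεu hB hspan
  have hunion := card_add_card_compl (univ.biUnion B)
  have hκ : w + 1 ≤ #(univ : Finset κ) := by
    by_contra! hlt
    have hle : #(univ.biUnion B) ≤ w * (r + ε) :=
      (card_biUnion_le_card_mul _ _ _ fun c _ => hBcard c).trans
        (Nat.mul_le_mul_right _ (by omega))
    linarith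
  have hdeficit : #(univ.biUnion B) + a ≤ #(univ : Finset κ) * (r + ε) :=
    le_trans (by omega) (Nat.mul_le_mul_right _ hκ)
  obtain ⟨G, -, hGcard, hG⟩ := exists_subset_card_biUnion_add_le hBcard hdeficit
  have := h.le_card_of_isRepairChain hv (by omega) (h.isRepairChain_biUnion hv hrv hB G (by omega))
  omega

end SmallNullity

section Codes

variable {ι E : Type*} [Field E]

/-- The coordinate functionals of a code, on which spans and ranks of sets of coordinates are
taken. -/
def coordFunctional (D : Submodule E (ι → E)) (i : ι) : Dual E D :=
  LinearMap.proj i ∘ₗ D.subtype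

theorem IsRepairSet.isSpanRepair {D : Submodule E (ι → E)} {r ε : ℕ} {B : Finset ι}
    (hB : IsRepairSet D r (ε + 1) B) : IsSpanRepair E (coordFunctional D) r ε B := by
  refine ⟨hB.1, fun L hLB hL => spanOn_le fun l hl => ?_⟩
  by_cases hlL : l ∈ L
  · exact mem_spanOn hlL
  obtain ⟨L', hL'L, hL'⟩ := exists_subset_card_eq (show #B - ε ≤ #L by omega)
  obtain ⟨a, ha⟩ := hB.2 l hl L' (hL'L.trans hLB) (fun h => hlL (hL'L h)) hL'
  have hsum : coordFunctional D l = ∑ i ∈ L', a i • coordFunctional D i :=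
    LinearMap.ext fun c => by simpa [coordFunctional] using ha c c.2
  rw [hsum]
  exact Submodule.sum_mem _ fun i hi => Submodule.smul_mem _ _ (mem_spanOn (hL'L hi))

theorem exists_ne_zero_of_rankOn_lt [Finite ι] {D : Submodule E (ι → E)} {T : Finset ι}
    (hT : rankOn E (coordFunctional D) T < finrank E D) : ∃ x ∈ D, x ≠ 0 ∧ ∀ i ∈ T, x i = 0 := by
  let W := spanOn E (coordFunctional D) T
  have hW : W.dualCoannihilator ≠ ⊥ := fun hbot => by
    have := Subspace.finrank_add_finrank_dualCoannihilator_eq W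
    rw [hbot, finrank_bot] at this
    exact hT.ne this
  obtain ⟨x, hxW, hx0⟩ := Submodule.exists_mem_ne_zero_of_ne_bot hW
  exact ⟨x, x.2, fun h => hx0 (Subtype.ext h), fun i hi =>
    Submodule.mem_dualCoannihilator _ |>.1 hxW _ (mem_spanOn hi)⟩

variable [Fintype ι]

theorem finrank_le_rankOn_univ (D : Submodule E (ι → E)) :
    finrank E D ≤ rankOn E (coordFunctional D) univ := by
  by_contra! hlt
  obtain ⟨x, -, hx0, hx⟩ := exists_ne_zero_of_rankOn_lt hlt
  exact hx0 (funext fun i => hx i (mem_univ i))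

theorem IsLinearCode.eq_zero_of_card_lt {C : Submodule E (ι → E)} {n k d : ℕ}
    (hC : IsLinearCode C n k d) {x : ι → E} (hx : x ∈ C) {J : Finset ι} (hJ : ∀ i ∉ J, x i = 0)
    (hlt : #J < d) : x = 0 := by
  classical
  by_contra hx0
  have hd : d ≤ hammingNorm x := hC.dist_isLeast.2
    ⟨x, hx, 0, C.zero_mem, hx0, by rw [← hammingDist_zero_right]⟩
  have hle : hammingNorm x ≤ #J :=
    card_le_card fun i hi => by_contra fun hiJ => (mem_filter.1 hi).2 (hJ i hiJ)
  omega

theorem exists_isLinearCode_of_forall_eq_zero {C : Submodule E (ι → E)} (hC : C ≠ ⊥) {t : ℕ}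
    (ht : ∀ x ∈ C, ∀ J : Finset ι, (∀ i ∉ J, x i = 0) → #J ≤ t → x = 0) :
    ∃ d, t < d ∧ IsLinearCode C (Fintype.card ι) (finrank E C) d := by
  classical
  let dists : Set ℕ := {e | ∃ x ∈ C, ∃ y ∈ C, x ≠ y ∧ hammingDist x y = e}
  have hne : dists.Nonempty := by
    obtain ⟨x, hx, hx0⟩ := C.ne_bot_iff.1 hC
    exact ⟨_, x, hx, 0, C.zero_mem, hx0, rfl⟩
  obtain ⟨x, hx, y, hy, hxy, hdist⟩ := Nat.sInf_mem hne
  have hleast : IsLeast dists (sInf dists) := ⟨Nat.sInf_mem hne, fun _ he => Nat.sInf_le he⟩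
  refine ⟨sInf dists, ?_, rfl, rfl, by convert hleast⟩
  by_contra! hle
  refine hxy (sub_eq_zero.1 (ht (x - y) (C.sub_mem hx hy) {i | x i ≠ y i} (fun i hi => ?_) ?_))
  · simpa [sub_eq_zero] using hi
  · exact hdist.trans_le hle

/-- The Singleton bound for the shortening of the code at `T`. -/
theorem IsLinearCode.add_card_le {D : Submodule E (ι → E)} {n k d : ℕ} (hD : IsLinearCode D n k d)
    {T : Finset ι} (hT : rankOn E (coordFunctional D) T < k) :
    d + k + #T ≤ n + 1 + rankOn E (coordFunctional D) T := by
  classical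
  obtain ⟨rfl, rfl, -⟩ := id hD
  have hcompl : finrank E D ≤ rankOn E (coordFunctional D) T + #Tᶜ := by
    refine (finrank_le_rankOn_univ D).trans ?_
    rw [← union_compl T]
    exact (rankOn_union_le _ _ _).trans (by gcongr; exact rankOn_le_card _ _)
  obtain ⟨Y, hYT, hY⟩ := exists_subset_card_eq
    (show finrank E D - 1 - rankOn E (coordFunctional D) T ≤ #Tᶜ by omega)
  have hrank : rankOn E (coordFunctional D) (T ∪ Y) < finrank E D := by
    have := rankOn_union_le (E := E) (coordFunctional D) T Y
    have := rankOn_le_card (E := E) (coordFunctional D) Y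
    omega
  obtain ⟨x, hxD, hx0, hx⟩ := exists_ne_zero_of_rankOn_lt hrank
  have hd : d ≤ #(T ∪ Y)ᶜ := by
    by_contra! hlt
    exact hx0 (hD.eq_zero_of_card_lt hxD (fun i hi => hx i (notMem_compl.1 hi)) hlt)
  have := card_add_card_compl (T ∪ Y)
  rw [card_union_of_disjoint (disjoint_compl_right.mono_right hYT)] at this
  omega

/-- For `δ = ε + 1` and `k = u * r + v` the Singleton-type bound of locally repairable codes,
`d ≤ n - k + 1 - (⌈k / r⌉ - 1) * (δ - 1)`, only gives `d + k + u * ε ≤ n + 1`. -/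
theorem IsLinearCode.add_add_le {D : Submodule E (ι → E)} {n k d r ε u v w a : ℕ}
    (hD : IsLinearCode D n k d) (hloc : HasAllSymbolLocality D r (ε + 1)) (hk : u * r + v ≤ k)
    (hn : n + a = (w + 1) * (r + ε)) (har : a ≤ r) (hrav : r < a + v) (hrv : r ≤ 2 * v)
    (hau : 2 * a ≤ u) (hεu : ε ≤ u) : d + k + (u + 1) * ε ≤ n + 1 := by
  by_contra! hlt
  refine not_hasSmallNullity (φ := coordFunctional D) (E := E) (hD.length_eq.symm ▸ hn) har hrav
    hrv hau hεu ⟨fun i => ?_, ?_, fun T hT => ?_⟩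
  · obtain ⟨B, hiB, hB⟩ := hloc i
    exact ⟨B, hiB, hB.isSpanRepair⟩
  · exact hk.trans (hD.dim_eq ▸ finrank_le_rankOn_univ D)
  · linarith [hD.add_card_le (hT.trans_le hk)]

theorem isOptimalLRC_of_forall_eq_zero {K : Type u} [Field K] {C : Submodule K (ι → K)}
    {n k r ε u v w a t : ℕ} (hcard : Fintype.card ι = n) (hkC : k ≤ finrank K C)
    (hloc : HasAllSymbolLocality C r (ε + 1))
    (ht : ∀ x ∈ C, ∀ J : Finset ι, (∀ i ∉ J, x i = 0) → #J ≤ t → x = 0)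
    (hk : k = u * r + v) (hnt : n = t + k + (u + 1) * ε) (hn : n + a = (w + 1) * (r + ε))
    (har : a ≤ r) (hrav : r < a + v) (hrv : r ≤ 2 * v) (hau : 2 * a ≤ u) (hεu : ε ≤ u) :
    IsOptimalLRC C n k (t + 1) r (ε + 1) := by
  have hC : C ≠ ⊥ := by
    rintro rfl
    rw [finrank_bot] at hkC
    omega
  obtain ⟨d, htd, hd⟩ := exists_isLinearCode_of_forall_eq_zero hC ht
  rw [hcard] at hd
  have hbound := hd.add_add_le hloc (hk ▸ hkC) hn har hrav hrv hau hεu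
  obtain rfl : d = t + 1 := by omega
  obtain hdim : finrank K C = k := by omega
  refine ⟨hdim ▸ hd, hloc, fun E _ _ D d' hD hDloc => ?_⟩
  have := hD.add_add_le hDloc hk.ge hn har hrav hrv hau hεu
  omega

end Codes

section Gabidulin

variable {F K : Type*} [Field F] [Fintype F] [Field K] [Algebra F K]

theorem sum_smul_pow_card_pow {ι : Type*} (s : Finset ι) (a : ι → F) (β : ι → K) (e : ℕ) :
    (∑ i ∈ s, a i • β i) ^ Fintype.card F ^ e = ∑ i ∈ s, a i • β i ^ Fintype.card F ^ e := by
  have hpow (z : K) : (FiniteField.frobeniusAlgHom F K ^ e) z = z ^ Fintype.card F ^ e := by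
    rw [AlgHom.coe_pow, FiniteField.coe_frobeniusAlgHom, pow_iterate]
  simp only [← hpow, map_sum, map_smul]

/-- The linearized polynomial `∑ e, c e * X ^ (q ^ e)`, the evaluation of which is linear over the
field with `q` elements. -/
noncomputable def linearizedPolynomial (q : ℕ) {K : Type*} [Field K] {s : ℕ} (c : Fin s → K) :
    Polynomial K :=
  ∑ e : Fin s, Polynomial.monomial (q ^ (e : ℕ)) (c e)

theorem eval_linearizedPolynomial (q : ℕ) {s : ℕ} (c : Fin s → K) (z : K) :
    (linearizedPolynomial q c).eval z = ∑ e : Fin s, c e * z ^ q ^ (e : ℕ) := by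
  simp [linearizedPolynomial, Polynomial.eval_finsetSum]

theorem eval_linearizedPolynomial_sum_smul {s : ℕ} (c : Fin s → K) {ι : Type*} (t : Finset ι)
    (a : ι → F) (β : ι → K) :
    (linearizedPolynomial (Fintype.card F) c).eval (∑ i ∈ t, a i • β i) =
      ∑ i ∈ t, a i • (linearizedPolynomial (Fintype.card F) c).eval (β i) := by
  simp only [eval_linearizedPolynomial, sum_smul_pow_card_pow, mul_sum, smul_sum, mul_smul_comm]
  exact sum_comm

theorem natDegree_linearizedPolynomial_lt {q : ℕ} (hq : 1 < q) {s : ℕ} (c : Fin s → K) :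
    (linearizedPolynomial q c).natDegree < q ^ s := by
  cases s with
  | zero => simp [linearizedPolynomial]
  | succ s =>
    refine (Polynomial.natDegree_sum_le_of_forall_le _ _ (n := q ^ s) fun e _ => ?_).trans_lt
      (Nat.pow_lt_pow_right hq (Nat.lt_succ_self s))
    exact (Polynomial.natDegree_monomial_le _).trans
      (Nat.pow_le_pow_right hq.le (Nat.lt_succ_iff.1 e.2))

theorem linearizedPolynomial_eq_zero_iff {q : ℕ} (hq : 1 < q) {s : ℕ} {c : Fin s → K} :
    linearizedPolynomial q c = 0 ↔ c = 0 := by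
  refine ⟨fun h => funext fun e => ?_, fun h => by simp [linearizedPolynomial, h]⟩
  have hcoeff := congrArg (Polynomial.coeff · (q ^ (e : ℕ))) h
  simpa [linearizedPolynomial, Polynomial.coeff_monomial, (Nat.pow_right_injective hq).eq_iff,
    Fin.val_inj] using hcoeff

/-- A linear dependence between the rows gives a linearized polynomial of degree less than `q ^ s`
that vanishes on the `q ^ s` elements of the `F`-span of `β`. -/
theorem det_mooreMatrix_ne_zero {s : ℕ} {β : Fin s → K} (hβ : LinearIndependent F β) :
    (mooreMatrix (Fintype.card F) s β).det ≠ 0 := by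
  intro hdet
  obtain ⟨c, hc0, hc⟩ := Matrix.exists_vecMul_eq_zero_iff.2 hdet
  have hq : 1 < Fintype.card F := Fintype.one_lt_card
  have hroot : ∀ l, (linearizedPolynomial (Fintype.card F) c).eval (β l) = 0 := fun l =>
    (eval_linearizedPolynomial _ c (β l)).trans (congrFun hc l)
  refine hc0 ((linearizedPolynomial_eq_zero_iff hq).1 ?_)
  refine Polynomial.eq_zero_of_natDegree_lt_card_of_eval_eq_zero _
    (linearIndependent_iff_injective_fintypeLinearCombination.1 hβ) (fun a => ?_) ?_
  · rw [Fintype.linearCombination_apply, eval_linearizedPolynomial_sum_smul]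
    simp [hroot]
  · simpa using natDegree_linearizedPolynomial_lt hq c

theorem linearIndependent_sum_coord_smul {F V W ι τ : Type*} [Field F] [AddCommGroup V] [Module F V]
    [AddCommGroup W] [Module F W] [Fintype ι] [Finite τ] {α : ι → V} {J : Finset ι}
    (hα : LinearIndepOn F α (J : Set ι)) (b : Basis τ F W) {y : ι → W}
    (hy : Submodule.span F (Set.range y) = ⊤) (hJ : ∀ p ∉ J, y p = 0) :
    LinearIndependent F fun t => ∑ p, b.coord t (y p) • α p := by
  classical
  have := Fintype.ofFinite τ
  refine Fintype.linearIndependent_iff.2 fun c hc => ?_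
  set f : Dual F W := ∑ t, c t • b.coord t
  have hf : ∑ p ∈ J, f (y p) • α p = 0 := by
    rw [sum_subset (subset_univ J) fun p _ hp => by simp [hJ p hp], ← hc]
    simp only [f, smul_sum, smul_smul, LinearMap.sum_apply, LinearMap.smul_apply, smul_eq_mul,
      sum_smul]
    exact sum_comm
  have hf0 : f = 0 := LinearMap.ext_on_range hy fun p => by
    by_cases hp : p ∈ J
    · exact linearIndepOn_finset_iff.1 hα (fun p => f (y p)) hf p hp
    · simp [hJ p hp]
  have hcoord : LinearIndependent F b.coord := b.coe_dualBasis ▸ b.dualBasis.linearIndependent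
  exact Fintype.linearIndependent_iff.1 hcoord c hf0

/-- A Gabidulin code, with parity checks `α p ^ q ^ e` for `e < h`, has rank distance greater than
`h`. If `b` is a basis of the `F`-span of `x`, then `∑ p, α p ^ q ^ e * x p` is
`∑ t, β t ^ q ^ e * b t`, where the `F`-independent elements `β t` are combinations of the `α p`
with the coordinates of the `x p` as coefficients. -/
theorem eq_zero_of_forall_sum_pow_mul_eq_zero {ι : Type*} [Fintype ι] {α x : ι → K} {J : Finset ι}
    {h : ℕ} (hα : LinearIndepOn F α (J : Set ι)) (hJ : ∀ p ∉ J, x p = 0)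
    (hx : rankOn F x univ ≤ h) (hsum : ∀ e < h, ∑ p, α p ^ Fintype.card F ^ e * x p = 0) :
    x = 0 := by
  set y : ι → spanOn F x univ := fun p => ⟨x p, mem_spanOn (mem_univ p)⟩
  set b := finBasis F (spanOn F x univ)
  set β : Fin (finrank F (spanOn F x univ)) → K := fun t => ∑ p, b.coord t (y p) • α p
  have hyJ : ∀ p ∉ J, y p = 0 := fun p hp => Subtype.ext (hJ p hp)
  have hspan : Submodule.span F (Set.range y) = ⊤ := by
    rw [Submodule.span_range_subtype_eq_top_iff, spanOn, coe_univ, Set.image_univ]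
  have hβ : LinearIndependent F β := linearIndependent_sum_coord_smul hα b hspan hyJ
  have hxy : ∀ p, x p = ∑ t, b.coord t (y p) • (b t : K) := fun p =>
    (congrArg Subtype.val (b.sum_repr (y p)).symm).trans (by
      simp only [Submodule.coe_sum, Submodule.coe_smul, Basis.coord_apply])
  have hb : (fun t => (b t : K)) = 0 := by
    refine Matrix.eq_zero_of_mulVec_eq_zero (det_mooreMatrix_ne_zero hβ) (funext fun e => ?_)
    calc ∑ t, β t ^ Fintype.card F ^ (e : ℕ) * b t
        = ∑ t, ∑ p, α p ^ Fintype.card F ^ (e : ℕ) * (b.coord t (y p) • (b t : K)) := by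
          simp only [β, sum_smul_pow_card_pow, sum_mul, smul_mul_assoc, mul_smul_comm]
      _ = ∑ p, α p ^ Fintype.card F ^ (e : ℕ) * x p := by
          rw [sum_comm]
          simp only [hxy, mul_sum]
      _ = 0 := hsum e (e.2.trans_le hx)
  ext p
  rw [hxy p]
  simp [congrFun hb _]

end Gabidulin

section ColumnIndependence

variable {F ρ κ : Type*} [Field F]

/-- Any `t` columns of `A` are linearly independent, that is, the code with parity-check matrix `A`
has minimum distance greater than `t`. -/
def HasIndependentColumns (A : Matrix ρ κ F) (t : ℕ) : Prop :=
  ∀ J : Finset κ, #J ≤ t → LinearIndepOn F A.col (J : Set κ)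

theorem IsLinearCode.hasIndependentColumns [Fintype κ] {A : Matrix ρ κ F} {n k d t : ℕ}
    (hA : IsLinearCode (parityCheckCode A) n k d) (ht : t < d) : HasIndependentColumns A t := by
  classical
  refine fun J hJ => linearIndepOn_finset_iff.2 fun f hf j hj => ?_
  set x : κ → F := fun j => if j ∈ J then f j else 0
  have hx : x ∈ parityCheckCode A := by
    refine LinearMap.mem_ker.2 (funext fun a => ?_)
    simpa [x, Matrix.mulVec, dotProduct, Finset.sum_apply, mul_comm] using congrFun hf a
  have hx0 : x = 0 := hA.eq_zero_of_card_lt hx (fun i hi => if_neg hi) (hJ.trans_lt ht)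
  simpa [x, hj] using congrFun hx0 j

namespace HasIndependentColumns

variable {A : Matrix ρ κ F} {t : ℕ}

theorem submatrix_id (hA : HasIndependentColumns A t) {κ' : Type*} {g : κ' → κ}
    (hg : Function.Injective g) : HasIndependentColumns (A.submatrix id g) t := fun J hJ => by
  classical
  refine LinearIndepOn.comp_of_image (f := g) (v := A.col) ?_ hg.injOn
  rw [← coe_image]
  exact hA _ (card_image_le.trans hJ)

variable [Finite ρ] [Fintype κ] {V : Type*} [AddCommGroup V] [Module F V]

/-- A functional vanishing on the columns outside `L` other than column `l`, but not on the latter,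
is a combination of parity checks that expresses the entry at `l` through those at `L`. -/
theorem exists_eq_sum_smul (hA : HasIndependentColumns A t) {L : Finset κ} {l : κ} (hl : l ∉ L)
    (hL : Fintype.card κ ≤ #L + t) :
    ∃ b : κ → F, ∀ y : κ → V, (∀ a, ∑ j, A a j • y j = 0) → y l = ∑ j ∈ L, b j • y j := by
  classical
  have := Fintype.ofFinite ρ
  have hindep := hA Lᶜ (by rw [card_compl]; omega)
  obtain ⟨f, hfl, hker⟩ := Submodule.exists_le_ker_of_notMem
    (hindep.notMem_span (mem_coe.2 (mem_compl.2 hl)))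
  have hf : ∀ j ∉ L, j ≠ l → f (A.col j) = 0 := fun j hjL hjl =>
    hker (Submodule.subset_span ⟨j, ⟨mem_coe.2 (mem_compl.2 hjL), hjl⟩, rfl⟩)
  refine ⟨fun j => -((f (A.col l))⁻¹ * f (A.col j)), fun y hy => ?_⟩
  obtain ⟨z, hz⟩ : ∃ z : ρ → F, ∀ j, f (A.col j) = ∑ a, z a * A a j :=
    ⟨_, fun j => (f.pi_apply_eq_sum_univ _).trans (sum_congr rfl fun _ _ => mul_comm _ _)⟩
  have hsum : ∑ j, f (A.col j) • y j = 0 :=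
    calc ∑ j, f (A.col j) • y j = ∑ a, z a • ∑ j, A a j • y j := by
          simp only [hz, sum_smul, mul_smul, smul_sum]
          exact sum_comm
      _ = 0 := by simp only [hy, smul_zero, sum_const_zero]
  rw [← sum_subset (subset_univ (insert l L)) fun j _ hj => by
    rw [hf j (fun h => hj (mem_insert_of_mem h)) fun h => hj (h ▸ mem_insert_self l L), zero_smul],
    sum_insert hl, add_eq_zero_iff_eq_neg] at hsum
  rw [← inv_smul_smul₀ hfl (y l), hsum, smul_neg, smul_sum, ← sum_neg_distrib]
  simp only [smul_smul, neg_smul]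

theorem rankOn_univ_le (hA : HasIndependentColumns A t) {y : κ → V} {J : Finset κ}
    (hJ : ∀ j ∉ J, y j = 0) (hy : ∀ a, ∑ j, A a j • y j = 0) : rankOn F y univ ≤ #J - t := by
  classical
  obtain ⟨J', hJ'J, hJ'⟩ := exists_subset_card_eq (min_le_left #J t)
  have hcard := card_sdiff_add_card_eq_card hJ'J
  suffices h : spanOn F y univ ≤ spanOn F y (J \ J') from
    (rankOn_le_of_spanOn_le h).trans ((rankOn_le_card _ _).trans (by omega))
  have hmem : ∀ j ∉ J', y j ∈ spanOn F y (J \ J') := fun j hj => by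
    by_cases hjJ : j ∈ J
    · exact mem_spanOn (mem_sdiff.2 ⟨hjJ, hj⟩)
    · rw [hJ j hjJ]
      exact Submodule.zero_mem _
  refine spanOn_le fun l _ => ?_
  by_cases hl : l ∈ J'
  · have := card_add_card_compl J'
    obtain ⟨b, hb⟩ := hA.exists_eq_sum_smul (V := V) (L := J'ᶜ) (notMem_compl.2 hl) (by omega)
    rw [hb y hy]
    exact Submodule.sum_mem _ fun j hj => Submodule.smul_mem _ _ (hmem j (mem_compl.1 hj))
  · exact hmem l hl

end HasIndependentColumns

theorem card_le_finrank_parityCheckCode_add [Fintype ρ] [Fintype κ] (A : Matrix ρ κ F) :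
    Fintype.card κ ≤ finrank F (parityCheckCode A) + Fintype.card ρ := by
  have hrank := A.mulVecLin.finrank_range_add_finrank_ker
  have hrange := Submodule.finrank_le (LinearMap.range A.mulVecLin)
  rw [finrank_fintype_fun_eq_card] at hrank hrange
  rw [parityCheckCode]
  omega

end ColumnIndependence

section BlockCode

variable {τ F K ρ : Type*} {κ : τ → Type*} [∀ i, Fintype (κ i)] [Finite ρ] [Field F]

theorem rankOn_sigma_le [Fintype τ] {V : Type*} [AddCommGroup V] [Module F V]
    {A : ∀ i, Matrix ρ (κ i) F} {t : ℕ} (hA : ∀ i, HasIndependentColumns (A i) t)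
    {x : (Σ i, κ i) → V} {J : ∀ i, Finset (κ i)} (hJ : ∀ i, ∀ j ∉ J i, x ⟨i, j⟩ = 0)
    (hx : ∀ i a, ∑ j, A i a j • x ⟨i, j⟩ = 0) : rankOn F x univ ≤ ∑ i, (#(J i) - t) := by
  classical
  have huniv : (univ : Finset (Σ i, κ i)) =
      univ.biUnion fun i => univ.map (Function.Embedding.sigmaMk i) := by
    ext ⟨i, j⟩
    simp
  rw [huniv]
  refine (rankOn_biUnion_le x _ _).trans (sum_le_sum fun i _ => ?_)
  rw [rankOn, spanOn_map]
  exact (hA i).rankOn_univ_le (hJ i) (hx i)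

theorem sum_tsub_le [Fintype τ] {f : τ → ℕ} {r t c h : ℕ} (hf : ∀ i, f i ≤ r + t)
    (hsum : ∑ i, f i ≤ h + c * t) (hc : c * r ≤ h + r) : ∑ i, (f i - t) ≤ h := by
  set P : Finset τ := {i | t < f i}
  have hP : ∑ i, (f i - t) = ∑ i ∈ P, (f i - t) :=
    (sum_filter_of_ne fun i _ hi => by omega).symm
  rw [hP]
  obtain hPc | hPc := le_or_gt c #P
  · have hPf : ∑ i ∈ P, (f i - t) + #P * t = ∑ i ∈ P, f i := by
      rw [← sum_const_nat fun _ _ => rfl, ← sum_add_distrib]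
      exact sum_congr rfl fun i hi => Nat.sub_add_cancel (mem_filter.1 hi).2.le
    have hPsum : ∑ i ∈ P, f i ≤ ∑ i, f i := sum_le_sum_of_subset (subset_univ P)
    have : c * t ≤ #P * t := by gcongr
    omega
  · have hPr : ∑ i ∈ P, (f i - t) ≤ #P * r :=
      sum_le_card_nsmul P _ r fun i _ => Nat.sub_le_iff_le_add.2 (hf i)
    have : (#P + 1) * r ≤ c * r := by gcongr; exact hPc
    linarith

variable [Field K] [Algebra F K] {r ε : ℕ}

theorem hasAllSymbolLocality_of_forall_block {A : ∀ i, Matrix ρ (κ i) F}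
    (hA : ∀ i, HasIndependentColumns (A i) ε) (hκ : ∀ i, Fintype.card (κ i) ≤ r + ε)
    {D : Submodule K ((Σ i, κ i) → K)}
    (hD : ∀ x ∈ D, ∀ i a, ∑ j, A i a j • x ⟨i, j⟩ = 0) : HasAllSymbolLocality D r (ε + 1) := by
  classical
  rintro ⟨i, l₀⟩
  refine ⟨univ.map (Function.Embedding.sigmaMk i), by simp, by simpa using hκ i, ?_⟩
  intro l hl L hL hlL hcard
  obtain ⟨l, -, rfl⟩ := mem_map.1 hl
  obtain ⟨L, -, rfl⟩ := subset_map_iff.1 hL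
  rw [card_map, card_map, card_univ, Nat.add_sub_cancel] at hcard
  obtain ⟨b, hb⟩ := (hA i).exists_eq_sum_smul (V := K) (L := L) (l := l)
    (fun h => hlL (mem_map_of_mem _ h)) (by omega)
  refine ⟨Function.extend (Sigma.mk i) (fun j => algebraMap F K (b j)) 0, fun x hx => ?_⟩
  rw [sum_map]
  simpa [sigma_mk_injective.extend_apply, Algebra.smul_def] using hb _ (hD x hx i)

theorem eq_zero_of_forall_block [Fintype τ] [Fintype F] {A : ∀ i, Matrix ρ (κ i) F} {c h : ℕ}
    (hA : ∀ i, HasIndependentColumns (A i) ε) (hκ : ∀ i, Fintype.card (κ i) ≤ r + ε)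
    (hc : c * r ≤ h + r) {α x : (Σ i, κ i) → K} {J : Finset (Σ i, κ i)}
    (hα : LinearIndepOn F α (J : Set (Σ i, κ i))) (hJ : ∀ p ∉ J, x p = 0)
    (hcard : #J ≤ h + c * ε) (hlocal : ∀ i a, ∑ j, A i a j • x ⟨i, j⟩ = 0)
    (hglobal : ∀ e < h, ∑ p, α p ^ Fintype.card F ^ e * x p = 0) : x = 0 := by
  classical
  let block : ∀ i, Finset (κ i) := fun i => {j | ⟨i, j⟩ ∈ J}
  have hblock : ∑ i, #(block i) = #J := by
    rw [← card_sigma]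
    congr 1
    ext
    simp [block]
  refine eq_zero_of_forall_sum_pow_mul_eq_zero hα hJ ?_ hglobal
  refine (rankOn_sigma_le (J := block) hA (fun i j hj => hJ _ (by simpa [block] using hj))
    hlocal).trans ?_
  exact sum_tsub_le (fun i => (card_le_univ _).trans (hκ i)) (hblock.trans_le hcard) hc

end BlockCode

section Construction

variable {F K : Type*} [Field F]

theorem IsWiseIndependent.linearIndepOn [Field K] [Algebra F K] {ι : Type*} {t : ℕ} {α : ι → K}
    (hind : IsWiseIndependent F t (Set.range α)) (hα : Function.Injective α) {J : Finset ι}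
    (hJ : #J ≤ t) : LinearIndepOn F α (J : Set ι) := by
  classical
  rw [linearIndepOn_iff_image hα.injOn, ← coe_image]
  exact hind _ (by simp) (card_image_le.trans hJ)

namespace ConstructionA

theorem card_coord {r δ m w : ℕ} (hm : m < r + δ - 1) (hw : r + δ - 1 - m ≤ w + 1) :
    Fintype.card (Coord r δ m w) = w * (r + δ - 1) + m := by
  have hcard : Fintype.card (Coord r δ m w) = ∑ i ∈ range (w + 1), blockSize r δ m i := by
    simp [Fintype.card_sigma, Fin.sum_univ_eq_sum_range (blockSize r δ m)]
  have hshort : #{i ∈ range (w + 1) | i < r + δ - 1 - m} = r + δ - 1 - m := by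
    rw [← card_range (r + δ - 1 - m)]
    congr 1
    ext i
    simp only [mem_filter, mem_range, card_range]
    omega
  have hblock : ∀ i, blockSize r δ m i + (if i < r + δ - 1 - m then 1 else 0) = r + δ - 1 := by
    intro i
    unfold blockSize
    split <;> omega
  have hsum : ∑ i ∈ range (w + 1), blockSize r δ m i + (r + δ - 1 - m) =
      (w + 1) * (r + δ - 1) := by
    conv_lhs =>
      rw [← hshort, card_filter, ← sum_add_distrib]
    simp [hblock]
  rw [Nat.succ_mul] at hsum
  omega

/-- The `i`-th diagonal block `R_i` of the parity-check matrix. -/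
def localCheck {r δ : ℕ} (A : Matrix (Fin (δ - 1)) (Fin (r + δ - 1)) F) (m i : ℕ) :
    Matrix (Fin (δ - 1)) (Fin (blockSize r δ m i)) F :=
  A.submatrix id (Fin.castLE (blockSize_le r δ m i))

variable [Fintype F] [Field K] [Algebra F K] {r δ m w h : ℕ}
  {A : Matrix (Fin (δ - 1)) (Fin (r + δ - 1)) F} {α : Coord r δ m w → K}

theorem mem_code {x : Coord r δ m w → K} :
    x ∈ code r δ m w h A α ↔
      (∀ (i : Fin (w + 1)) a, ∑ j, localCheck A m i a j • x ⟨i, j⟩ = 0) ∧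
        ∀ e < h, ∑ p, α p ^ Fintype.card F ^ e * x p = 0 := by
  have hlocal (i : Fin (w + 1)) (a : Fin (δ - 1)) :
      (parityCheck r δ m w h A α).mulVec x (.inl (i, a)) =
        ∑ j, localCheck A m i a j • x ⟨i, j⟩ := by
    rw [Matrix.mulVec, dotProduct, Fintype.sum_sigma, Fintype.sum_eq_single i]
    · simp [parityCheck, localCheck, Algebra.smul_def]
    · intro i' hi'
      simp [parityCheck, hi'.symm]
  have hglobal (e : Fin h) : (parityCheck r δ m w h A α).mulVec x (.inr e) =
      ∑ p, α p ^ Fintype.card F ^ (e : ℕ) * x p := rfl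
  rw [code, parityCheckCode, LinearMap.mem_ker, Matrix.mulVecLin_apply, funext_iff, Sum.forall,
    Prod.forall]
  simp only [hlocal, hglobal, Pi.zero_apply, Fin.forall_iff (n := h)]

theorem card_le_finrank_code_add :
    Fintype.card (Coord r δ m w) ≤
      finrank K (code r δ m w h A α) + ((w + 1) * (δ - 1) + h) := by
  have := card_le_finrank_parityCheckCode_add (parityCheck r δ m w h A α)
  rwa [Fintype.card_sum, Fintype.card_prod, Fintype.card_fin, Fintype.card_fin,
    Fintype.card_fin] at this

theorem hasAllSymbolLocality_code (hδ : 1 ≤ δ) (hA : HasIndependentColumns A (δ - 1)) :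
    HasAllSymbolLocality (code r δ m w h A α) r δ := by
  obtain ⟨ε, rfl⟩ := Nat.exists_eq_add_of_le' hδ
  exact hasAllSymbolLocality_of_forall_block (A := fun i : Fin (w + 1) => localCheck A m i)
    (fun _ => hA.submatrix_id (Fin.castLE_injective _))
    (fun i => (Fintype.card_fin _).trans_le (blockSize_le r (ε + 1) m i))
    fun _ hx => (mem_code.1 hx).1

theorem eq_zero_of_mem_code (hδ : 1 ≤ δ) (hA : HasIndependentColumns A (δ - 1)) {c : ℕ}
    (hc : c * r ≤ h + r) (hα : Function.Injective α)
    (hind : IsWiseIndependent F (h + c * (δ - 1)) (Set.range α)) {x : Coord r δ m w → K}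
    (hx : x ∈ code r δ m w h A α) {J : Finset (Coord r δ m w)} (hJ : ∀ p ∉ J, x p = 0)
    (hcard : #J ≤ h + c * (δ - 1)) : x = 0 := by
  obtain ⟨ε, rfl⟩ := Nat.exists_eq_add_of_le' hδ
  exact eq_zero_of_forall_block (A := fun i : Fin (w + 1) => localCheck A m i)
    (fun _ => hA.submatrix_id (Fin.castLE_injective _))
    (fun i => (Fintype.card_fin _).trans_le (blockSize_le r (ε + 1) m i)) hc
    (hind.linearIndepOn hα hcard) hJ hcard (mem_code.1 hx).1 (mem_code.1 hx).2

end ConstructionA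

end Construction

theorem theorem3_general {F : Type v} {K : Type u} [Field F] [Fintype F] [Field K] [Algebra F K]
    (n k r δ w m u v h : ℕ) (hδ : 1 ≤ δ) (hn : n = w * (r + δ - 1) + m) (hδm : δ ≤ m + 1)
    (hk : k = u * r + v) (hvr : v ≤ r) (hmv : m + 1 < v + δ) (hrv : r ≤ 2 * v)
    (hum : 2 * (r + δ - 1 - m) ≤ u) (hδu : δ - 1 ≤ u) (hh : n = h + k + (w + 1) * (δ - 1))
    (A : Matrix (Fin (δ - 1)) (Fin (r + δ - 1)) F)
    (hA : IsLinearCode (parityCheckCode A) (r + δ - 1) r δ)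
    (α : ConstructionA.Coord r δ m w → K) (hα : Function.Injective α)
    (hind : IsWiseIndependent F (h + (w - u) * (δ - 1)) (Set.range α)) :
    IsOptimalLRC (ConstructionA.code r δ m w h A α) n k (h + (w - u) * (δ - 1) + 1) r δ := by
  have hindep : HasIndependentColumns A (δ - 1) := hA.hasIndependentColumns (by omega)
  have hloc := ConstructionA.hasAllSymbolLocality_code (m := m) (w := w) (h := h) (α := α) hδ hindep
  have hkC := ConstructionA.card_le_finrank_code_add (h := h) (A := A) (α := α)
  obtain ⟨ε, rfl⟩ := Nat.exists_eq_add_of_le' hδ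
  obtain ⟨a, ha⟩ : ∃ a, r + ε = m + a := Nat.exists_eq_add_of_le (by omega)
  change ε ≤ u at hδu
  change n = h + k + (w + 1) * ε at hh
  change n = w * (r + ε) + m at hn
  change _ ≤ _ + ((w + 1) * ε + h) at hkC
  have hwr : (w + 1) * r = h + (u * r + v + a) := by linarith
  have huw : u < w := by
    by_contra! hwu
    have : (w + 1) * r ≤ (u + 1) * r := by gcongr
    linarith [show r < v + a by omega]
  have hcard : Fintype.card (ConstructionA.Coord r (ε + 1) m w) = n :=
    (ConstructionA.card_coord (by omega) (by omega)).trans hn.symm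
  obtain ⟨c, rfl⟩ := Nat.exists_eq_add_of_le huw.le
  rw [Nat.add_sub_cancel_left] at hind ⊢
  exact isOptimalLRC_of_forall_eq_zero (w := u + c) (a := a) hcard (by omega) hloc
    (fun x hx J hJ => ConstructionA.eq_zero_of_mem_code hδ hindep (by linarith) hα hind hx hJ) hk
    (hh.trans (by dsimp; ring)) (by linarith) (by omega) (by omega) hrv (by omega) hδu

theorem theorem3 {F : Type v} {K : Type u} [Field F] [Fintype F] [Field K] [Fintype K]
    [Algebra F K]
    (n k r δ w m u v h : ℕ)
    (hδ : 2 ≤ δ)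
    (hn : n = w * (r + δ - 1) + m) (hδm : δ ≤ m) (hm : m < r + δ - 1)
    (hk : k = u * r + v) (hvr : v < r) (hv : max (m - δ + 1) (r / 2) < v)
    (hu : max (2 * (r + δ - 1 - m)) (r + δ - 1) ≤ u)
    (hh : (h : ℤ) = (n : ℤ) - k - (w + 1) * ((δ : ℤ) - 1))
    (A : Matrix (Fin (δ - 1)) (Fin (r + δ - 1)) F)
    (hA : IsLinearCode (parityCheckCode A) (r + δ - 1) r δ)
    (S : Finset K) (hS : S.card = n)
    (hind : IsWiseIndependent F (h + (w - u) * (δ - 1)) (S : Set K))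
    (α : ConstructionA.Coord r δ m w ≃ S) :
    IsOptimalLRC (ConstructionA.code r δ m w h A (fun j => (α j : K)))
      n k (h + (w - u) * (δ - 1) + 1) r δ := by
  have hrange : Set.range (fun j => (α j : K)) = S := by
    rw [show (fun j => (α j : K)) = Subtype.val ∘ α from rfl, EquivLike.range_comp]
    exact Subtype.range_coe
  have hh' : n = h + k + (w + 1) * (δ - 1) := by
    zify [show 1 ≤ δ by omega]
    linarith
  exact theorem3_general n k r δ w m u v h (by omega) hn (by omega) hk hvr.le (by omega)
    (by omega) (by omega) (by omega) hh' A hA _ (Subtype.val_injective.comp α.injective)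
    (hrange ▸ hind)
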